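/- Let $S$ be a Noetherian integrally closed domain with field of fractions $L$ of characteristic $0$, such that $2$ is a prime element of $S$ and $S/2S$ is integrally closed. Call $x\in S$ square free if $QS_Q=xS_Q$ for every height one prime $Q$ of $S$ containing $x$. Let $f,g\in S$ be square free elements that are not squares in $S$ and do not lie in a common height one prime of $S$. Let $K=L(\omega,\mu)$ be a field extension of $L$ with $\omega^2=f$, $\mu^2=g$, such that $U^2-g$ is irreducible over $L(\omega)$ (so that $[K:L]=4$), and let $R$ be the integral closure of $S$ in $K$. Assume that $f$ and $g$ are squares modulo $2S$, and write $f=h_1^2+2a$, $g=h_2^2+2b$ with $h_1,h_2,a,b\in S$. Put $\tau_1=(\omega+h_1)/2$ and $\tau_2=(\mu+h_2)/2$. If at least one of the rings $S[\omega]$, $S[\mu]$ is not integrally closed, then $R$ is a free $S$-module. More precisely, $R=S[\tau_1,\tau_2]$ if neither $S[\omega]$ nor $S[\mu]$ is integrally closed; $R=S[\tau_1,\mu]$ if $S[\mu]$ is integrally closed and $S[\omega]$ is not; and $R=S[\omega,\tau_2]$ if $S[\omega]$ is integrally closed and $S[\mu]$ is not. Consequently, if $S$ is regular, then $R$ is Cohen–Macaulay.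 -/

import Mathlib

/-- `x` is square free: for every height one prime `Q` of `S` containing `x`, one has
`Q S_Q = x S_Q`. -/
def IsSquareFreeElt {S : Type*} [CommRing S] (x : S) : Prop :=
  ∀ (Q : Ideal S) [Q.IsPrime], Q.height = 1 → x ∈ Q →
    Q.map (algebraMap S (Localization.AtPrime Q)) =
      Ideal.span {algebraMap S (Localization.AtPrime Q) x}

/-- No height one prime of `S` contains both `x` and `y`. -/
def NoCommonHeightOnePrime {S : Type*} [CommRing S] (x y : S) : Prop :=
  ∀ Q : Ideal S, Q.IsPrime → Q.height = 1 → ¬ (x ∈ Q ∧ y ∈ Q)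

/-- The list `rs` is a system of parameters of the local ring `R`: it has `dim R` members, and
they generate an ideal primary to the maximal ideal. -/
def IsSystemOfParams (R : Type*) [CommRing R] [IsLocalRing R] (rs : List R) : Prop :=
  (rs.length : WithBot ℕ∞) = ringKrullDim R ∧
    (Ideal.ofList rs).radical = IsLocalRing.maximalIdeal R

/-- A Noetherian local ring is Cohen-Macaulay if some (equivalently, every) system of parameters
is a regular sequence. -/
def IsCohenMacaulayLocal (R : Type*) [CommRing R] [IsLocalRing R] : Prop :=
  IsNoetherianRing R ∧
    ∃ rs : List R, IsSystemOfParams R rs ∧ RingTheory.Sequence.IsRegular R rs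

/-- A Noetherian ring is Cohen-Macaulay if its localizations at all maximal ideals are. -/
def IsCohenMacaulay (R : Type*) [CommRing R] : Prop :=
  IsNoetherianRing R ∧
    ∀ (m : Ideal R) [m.IsMaximal], IsCohenMacaulayLocal (Localization.AtPrime m)

/-- `S` is regular: its localizations at all maximal ideals are regular local rings. This covers
regular local rings `S` as well as Mathlib's `IsRegularRing S`. -/
def IsRegularAtMaximals (S : Type*) [CommRing S] : Prop :=
  IsNoetherianRing S ∧
    ∀ (m : Ideal S) [m.IsMaximal], IsRegularLocalRing (Localization.AtPrime m)

/-! Denominators of integral elements are powers of 2. Write an integral x in K as c₀ + c₁ω + c₂μ +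
c₃ωμ with cᵢ in L. Conjugating μ, then ω, shows that 4cᵢρ is integral for the matching ρ in {1, ω,
μ, ωμ}. Since f, g and fg are square free, 4cᵢ lies in S
(`IsSquareFreeElt.mem_range_of_sq_mul_mem`), so 4x lies in S[ω, μ] (`IsBiquadratic.four_mul_mem`).
It remains to find a ring A of integral elements, containing ω and μ, that is closed at 2: x in A
and x/2 integral imply x/2 in A.

Such an A is built by two quadratic steps, each of the form A = B ⊕ Bt, which also gives freeness.
If 2 divides a, then τ₁ is a root of T² - h₁T - a/2. Its discriminant is h₁² modulo 2, and 2 does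
not divide h₁ because 4 does not divide f. The step is generically étale modulo 2, so 2 stays
radical (`IsQuadraticOver.twoRadical`), which implies closedness at 2. If 2 does not divide b, then
μ + h₂ is a root of T² - 2h₂T - 2b, an Eisenstein polynomial at 2. Adjoining it to a ring in which 2
is radical gives a ring closed at 2 (`IsQuadraticOver.twoClosed`). An Eisenstein step must therefore
come after the étale one. The same computations over S show that S[ω] is integrally closed exactly
when 2 does not divide a.

For Cohen–Macaulayness, a regular sequence generating the maximal ideal of a localization of S stays
regular in R by flatness, and it is a system of parameters there by integrality. -/

/-! ### Square free elements and denominators -/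

/-- In a Noetherian ring, every proper ideal `I` has an associated prime. -/
lemma Ideal.exists_isPrime_mem_iff_mul_mem {S : Type*} [CommRing S] [IsNoetherianRing S]
    {I : Ideal S} (hI : I ≠ ⊤) :
    ∃ Q : Ideal S, Q.IsPrime ∧ ∃ r : S, ∀ t, t ∈ Q ↔ t * r ∈ I := by
  have := Ideal.Quotient.nontrivial_iff.mpr hI
  obtain ⟨Q, hQ, -⟩ :=
    exists_le_isAssociatedPrime_of_isNoetherianRing S (1 : S ⧸ I) one_ne_zero
  obtain ⟨hQ, x, hx⟩ := isAssociatedPrime_iff.mp hQ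
  obtain ⟨r, rfl⟩ := Ideal.Quotient.mk_surjective x
  refine ⟨Q, hQ, r, fun t ↦ ?_⟩
  rw [hx, Submodule.mem_colon_singleton, Submodule.mem_bot, ← Ideal.Quotient.eq_zero_iff_mem]
  rfl

lemma IsSquareFreeElt.exists_mul_eq {S : Type*} [CommRing S] {f : S} (hf : IsSquareFreeElt f)
    {Q : Ideal S} [Q.IsPrime] (hQ : Q.height = 1) (hfQ : f ∈ Q) {t : S} (ht : t ∈ Q) :
    ∃ w ∉ Q, ∃ e, w * t = f * e := by
  have h : algebraMap S (Localization.AtPrime Q) t ∈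
      (Ideal.span {f}).map (algebraMap S (Localization.AtPrime Q)) := by
    rw [Ideal.map_span, Set.image_singleton, ← hf Q hQ hfQ]
    exact Ideal.mem_map_of_mem _ ht
  rw [IsLocalization.algebraMap_mem_map_algebraMap_iff Q.primeCompl] at h
  obtain ⟨w, hw, h⟩ := h
  exact ⟨w, hw, Ideal.mem_span_singleton.mp h⟩

/-- At a height one prime containing the product, one of the two factors becomes a unit in the
localization. -/
lemma IsSquareFreeElt.mul {S : Type*} [CommRing S] {f g : S} (hf : IsSquareFreeElt f)
    (hg : IsSquareFreeElt g) (hfg : NoCommonHeightOnePrime f g) : IsSquareFreeElt (f * g) := by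
  intro Q hQ hQ1 hmem
  have key : ∀ x : S, x ∉ Q → IsUnit (algebraMap S (Localization.AtPrime Q) x) := fun x hx ↦
    IsLocalization.map_units (M := Q.primeCompl) _ ⟨x, hx⟩
  rcases hQ.mem_or_mem hmem with h | h
  · rw [map_mul, Ideal.span_singleton_mul_right_unit (key g fun h' ↦ hfg Q hQ hQ1 ⟨h, h'⟩)]
    exact hf Q hQ1 h
  · rw [mul_comm f, map_mul, Ideal.span_singleton_mul_right_unit
      (key f fun h' ↦ hfg Q hQ hQ1 ⟨h', h⟩)]
    exact hg Q hQ1 h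

/-- Over a Noetherian integrally closed domain, if `y ^ 2 * f` is integral with `f` square free,
then so is `y`. -/
lemma IsSquareFreeElt.mem_range_of_sq_mul_mem {S L : Type*} [CommRing S] [IsDomain S]
    [IsNoetherianRing S] [IsIntegrallyClosed S] [Field L] [Algebra S L] [IsFractionRing S L]
    {f : S} (hf : IsSquareFreeElt f) {y : L}
    (hy : ∃ c, algebraMap S L c = y ^ 2 * algebraMap S L f) : ∃ s, algebraMap S L s = y := by
  by_contra hcon
  have inj := IsFractionRing.injective S L
  -- `D z` is the ideal of denominators of z. Below, Q is an associated prime of `D y`, and z = ry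
  -- has denominator ideal exactly Q.
  let D (z : L) : Ideal S :=
    (LinearMap.range (Algebra.linearMap S L)).comap (LinearMap.toSpanSingleton S L z)
  have hD (z : L) (t : S) : t ∈ D z ↔ ∃ s, algebraMap S L s = algebraMap S L t * z := by
    simp [D, Algebra.smul_def]
  obtain ⟨Q, hQ, r, hr⟩ := Ideal.exists_isPrime_mem_iff_mul_mem (I := D y) fun h ↦ hcon <| by
    have : (1 : S) ∈ D y := h ▸ Submodule.mem_top
    simpa [hD] using this
  set z := algebraMap S L r * y with hz
  have hQz (t : S) : t ∈ Q ↔ ∃ s, algebraMap S L s = algebraMap S L t * z := by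
    rw [hr, hD, map_mul, mul_assoc]
  have hQ0 : Q ≠ ⊥ := by
    obtain ⟨p, q, hq, hpq⟩ := IsFractionRing.div_surjective (A := S) z
    have hq0 : algebraMap S L q ≠ 0 := by simpa using nonZeroDivisors.ne_zero hq
    have : q ∈ Q := (hQz q).mpr ⟨p, by rw [← hpq]; field_simp⟩
    rintro rfl
    exact nonZeroDivisors.ne_zero hq (by simpa using this)
  -- Otherwise zQ ⊆ Q, so z is integral by the determinant trick and lies in S, giving 1 ∈ Q. The
  -- resulting t generates Q locally, so Q has height one by Krull's principal ideal theorem.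
  obtain ⟨t, ht, u, hu, huz⟩ : ∃ t ∈ Q, ∃ u ∉ Q, algebraMap S L u = algebraMap S L t * z := by
    by_contra! h
    have hint : IsIntegral S z := by
      refine isIntegral_of_smul_mem_submodule (Submodule.map (Algebra.linearMap S L) Q) ?_
        (IsNoetherian.noetherian Q |>.map _) z ?_
      · intro h0
        refine hQ0 (Submodule.map_injective_of_injective (f := Algebra.linearMap S L) inj ?_)
        rw [h0, Submodule.map_bot]
      · rintro _ ⟨t, ht, rfl⟩
        obtain ⟨s, hs⟩ := (hQz t).mp ht
        by_cases hsQ : s ∈ Q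
        · exact ⟨s, hsQ, by simp [hs, mul_comm]⟩
        · exact absurd hs (h t ht s hsQ)
    obtain ⟨s, hs⟩ := IsIntegrallyClosed.isIntegral_iff.mp hint
    exact hQ.one_notMem ((hQz 1).mpr ⟨s, by simpa using hs⟩)
  have hloc {x : S} (hx : x ∈ Q) : ∃ e, x * u = t * e := by
    obtain ⟨s, hs⟩ := (hQz x).mp hx
    exact ⟨s, inj (by rw [map_mul, map_mul, huz, hs]; ring)⟩
  have hQ1 : Q.height = 1 := by
    refine le_antisymm (Ideal.height_le_one_of_isPrincipal_of_mem_minimalPrimes (Ideal.span {t}) Q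
      ⟨⟨hQ, by simpa [Ideal.span_singleton_le_iff_mem]⟩, ?_⟩)
      (Order.one_le_iff_ne_zero.mpr (Ideal.height_eq_zero_iff_eq_bot.not.mpr hQ0))
    rintro P ⟨hP, htP⟩ hPQ x hx
    obtain ⟨e, he⟩ := hloc hx
    refine (hP.mem_or_mem (he ▸ P.mul_mem_right e (htP (Ideal.mem_span_singleton_self t)))).resolve_right
      fun h ↦ hu (hPQ h)
  obtain ⟨c, hc⟩ := hy
  -- At Q, z = u/t has valuation -1 and f has valuation at most 1, so z²f = r²c would have negative
  -- valuation. The rest is this contradiction with denominators cleared.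
  have hfu : u ^ 2 * f = t ^ 2 * (r ^ 2 * c) := inj <| by
    simp only [map_mul, map_pow, huz, hc, hz]; ring
  have hfQ : f ∈ Q := (hQ.mem_or_mem (hfu ▸ Q.mul_mem_right _ (Q.pow_mem_of_mem ht 2 two_pos) :
    u ^ 2 * f ∈ Q)).resolve_left fun h ↦ hu (hQ.mem_of_pow_mem 2 h)
  obtain ⟨w, hw, e, he⟩ := hf.exists_mul_eq hQ1 hfQ ht
  have ht0 : t ≠ 0 := by
    rintro rfl
    exact hu (by rw [inj (by simpa using huz : algebraMap S L u = algebraMap S L 0)]; exact Q.zero_mem)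
  have : u ^ 2 * w = t * (r ^ 2 * c * e) := mul_left_cancel₀ ht0 (by linear_combination u ^ 2 * he + e * hfu)
  rcases hQ.mem_or_mem (this ▸ Q.mul_mem_right _ ht : u ^ 2 * w ∈ Q) with h | h
  · exact hu (hQ.mem_of_pow_mem 2 h)
  · exact hw h

/-- A square free element is not divisible by the square of a prime element. -/
lemma IsSquareFreeElt.not_sq_dvd {S : Type*} [CommRing S] [IsDomain S] [IsNoetherianRing S] {f p : S}
    (hf : IsSquareFreeElt f) (hp : Prime p) : ¬ p ^ 2 ∣ f := by
  rintro ⟨e, he⟩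
  have hprime : (Ideal.span {p}).IsPrime := (Ideal.span_singleton_prime hp.ne_zero).mpr hp
  have hQ1 : (Ideal.span {p}).height = 1 := by
    refine le_antisymm (Ideal.height_le_one_of_isPrincipal_of_mem_minimalPrimes (Ideal.span {p}) _
      ⟨⟨hprime, le_rfl⟩, fun _ h _ ↦ h.2⟩)
      (Order.one_le_iff_ne_zero.mpr (Ideal.height_eq_zero_iff_eq_bot.not.mpr (by simpa using hp.ne_zero)))
  obtain ⟨w, hw, e', he'⟩ := hf.exists_mul_eq hQ1
    (Ideal.mem_span_singleton.mpr ((Dvd.intro_left _ (by ring) : p ∣ p ^ 2).trans ⟨e, he⟩))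
    (Ideal.mem_span_singleton_self p)
  refine hw (Ideal.mem_span_singleton.mpr ⟨e * e', mul_right_cancel₀ hp.ne_zero ?_⟩)
  rw [he', he]; ring

/-! ### Conjugation and adjunction of quadratic elements -/

/-- Conjugation in a quadratic field extension preserves integrality. -/
lemma IsIntegral.sub_mul_of_sq_eq {S E K : Type*} [CommRing S] [Field E] [Field K] [Algebra E K]
    [Algebra S E] [Algebra S K] [IsScalarTower S E K] {g u v : E} {μ : K}
    (hμ : μ ^ 2 = algebraMap E K g) (hnot : ∀ e, algebraMap E K e ≠ μ)
    (h : IsIntegral S (algebraMap E K u + algebraMap E K v * μ)) :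
    IsIntegral S (algebraMap E K u - algebraMap E K v * μ) := by
  -- Conjugation is performed in E[T]/(T² - g), which embeds in K because μ ∉ E; no automorphism of
  -- K is needed.
  let φ : QuadraticAlgebra E g 0 →ₐ[E] K :=
    QuadraticAlgebra.lift ⟨μ, by rw [← pow_two, hμ, zero_smul, add_zero, Algebra.smul_def, mul_one]⟩
  have hφ (z : QuadraticAlgebra E g 0) :
      φ z = algebraMap E K z.re + algebraMap E K z.im * μ := by
    simp [φ, QuadraticAlgebra.lift, Algebra.smul_def]
  have hinj : Function.Injective φ := by
    refine (injective_iff_map_eq_zero φ).mpr fun z hz ↦ ?_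
    rw [hφ] at hz
    have him : z.im = 0 := by
      by_contra him
      have him' : algebraMap E K z.im ≠ 0 := by simpa using him
      refine hnot (-z.re / z.im) ?_
      rw [map_div₀, map_neg, div_eq_iff him']
      linear_combination -hz
    exact QuadraticAlgebra.ext (by simpa [him] using hz) him
  have h1 : IsIntegral S (⟨u, v⟩ : QuadraticAlgebra E g 0) := by
    refine (isIntegral_algHom_iff (φ.restrictScalars S) hinj).mp ?_
    simpa [hφ] using h
  let σ : QuadraticAlgebra E g 0 →ₐ[S] QuadraticAlgebra E g 0 :=
    { starRingEnd (QuadraticAlgebra E g 0) with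
      commutes' r := by
        ext <;> simp [IsScalarTower.algebraMap_apply S E (QuadraticAlgebra E g 0), starRingEnd_apply] }
  have h2 := (h1.map σ).map (φ.restrictScalars S)
  have h3 : (φ.restrictScalars S) (σ ⟨u, v⟩) = algebraMap E K u - algebraMap E K v * μ := by
    change φ (star ⟨u, v⟩) = _
    simp [hφ, sub_eq_add_neg]
  rwa [h3] at h2

lemma Algebra.mem_adjoin_insert_iff_of_sq_eq {S K : Type*} [CommRing S] [CommRing K] [Algebra S K]
    {s : Set K} {t p q : K} (hp : p ∈ Algebra.adjoin S s) (hq : q ∈ Algebra.adjoin S s)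
    (ht : t ^ 2 = p * t + q) (x : K) :
    x ∈ Algebra.adjoin S (insert t s) ↔
      ∃ u ∈ Algebra.adjoin S s, ∃ v ∈ Algebra.adjoin S s, x = u + v * t := by
  constructor
  · intro hx
    induction hx using Algebra.adjoin_induction with
    | mem x hx =>
      rcases hx with rfl | hx
      · exact ⟨0, zero_mem _, 1, one_mem _, by ring⟩
      · exact ⟨x, Algebra.subset_adjoin hx, 0, zero_mem _, by ring⟩
    | algebraMap r => exact ⟨_, algebraMap_mem _ r, 0, zero_mem _, by ring⟩
    | add x y _ _ hx hy =>
      obtain ⟨u, hu, v, hv, rfl⟩ := hx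
      obtain ⟨u', hu', v', hv', rfl⟩ := hy
      exact ⟨_, add_mem hu hu', _, add_mem hv hv', by ring⟩
    | mul x y _ _ hx hy =>
      obtain ⟨u, hu, v, hv, rfl⟩ := hx
      obtain ⟨u', hu', v', hv', rfl⟩ := hy
      exact ⟨_, add_mem (mul_mem hu hu') (mul_mem (mul_mem hv hv') hq), _,
        add_mem (add_mem (mul_mem hu hv') (mul_mem hv hu')) (mul_mem (mul_mem hv hv') hp),
        by linear_combination v * v' * ht⟩
  · rintro ⟨u, hu, v, hv, rfl⟩
    have hle : Algebra.adjoin S s ≤ Algebra.adjoin S (insert t s) :=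
      Algebra.adjoin_mono (Set.subset_insert t s)
    exact add_mem (hle hu) (mul_mem (hle hv) (Algebra.subset_adjoin (Set.mem_insert t s)))

lemma Algebra.mem_adjoin_singleton_iff_of_sq_eq {S K : Type*} [CommRing S] [CommRing K]
    [Algebra S K] {t : K} {p q : S} (ht : t ^ 2 = algebraMap S K p * t + algebraMap S K q) (x : K) :
    x ∈ Algebra.adjoin S {t} ↔ ∃ c d, x = algebraMap S K c + algebraMap S K d * t := by
  have h := Algebra.mem_adjoin_insert_iff_of_sq_eq (s := ∅) (algebraMap_mem _ p)
    (algebraMap_mem _ q) ht x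
  rw [insert_empty_eq] at h
  simp [h, Algebra.mem_bot]

/-! ### Radicality and closedness at 2 in quadratic extensions -/

section Two

variable {S K : Type*} [CommRing S] [Field K] [Algebra S K]

/-- The ideal `2B` is radical. -/
def TwoRadical (B : Subalgebra S K) : Prop := ∀ x ∈ B, x ^ 2 / 2 ∈ B → x / 2 ∈ B

/-- The element `c` is not a zero divisor modulo `2B`. -/
def TwoRegular (B : Subalgebra S K) (c : K) : Prop := ∀ x ∈ B, c * x / 2 ∈ B → x / 2 ∈ B

/-- Every integral element `x / 2` with `x` in `B` lies in `B`. -/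
def TwoClosed (B : Subalgebra S K) : Prop := ∀ x ∈ B, IsIntegral S (x / 2) → x / 2 ∈ B

/-- Radicality is stated for squares only, so the exponent n is first raised to 2 ^ n and then
halved repeatedly. -/
lemma TwoRadical.of_pow {B : Subalgebra S K} (hB : TwoRadical B) {x : K} (hx : x ∈ B) {n : ℕ}
    (hn : x ^ n / 2 ∈ B) : x / 2 ∈ B := by
  have key (k : ℕ) (h : x ^ 2 ^ k / 2 ∈ B) : x / 2 ∈ B := by
    induction k with
    | zero => simpa using h
    | succ k ih => exact ih (hB _ (pow_mem hx _) (by rwa [← pow_mul, ← pow_succ]))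
  refine key n ?_
  rw [← Nat.sub_add_cancel (Nat.lt_two_pow_self (n := n)).le, pow_add, mul_div_assoc]
  exact mul_mem (pow_mem hx _) hn

/-- Multiplying a monic equation of degree n for x/2 by 2 ^ n leaves a factor 2 ^ (n - i) with i < n
on every lower term, so x ^ n is divisible by 2 in B. -/
lemma IsIntegral.exists_pow_div_two_mem [NeZero (2 : K)] {B : Subalgebra S K} {x : K} (hx : x ∈ B)
    (h : IsIntegral S (x / 2)) : ∃ n : ℕ, x ^ n / 2 ∈ B := by
  obtain ⟨P, hP, h0⟩ := h
  refine ⟨P.natDegree, ?_⟩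
  have h2 : (2 : K) ≠ 0 := NeZero.ne _
  rw [Polynomial.eval₂_eq_sum_range, Finset.sum_range_succ, hP.coeff_natDegree, map_one, one_mul]
    at h0
  have h1 : x ^ P.natDegree / 2 = -∑ i ∈ Finset.range P.natDegree,
      algebraMap S K (P.coeff i) * x ^ i * 2 ^ (P.natDegree - i - 1) := by
    have h3 : x ^ P.natDegree / 2 = 2 ^ P.natDegree / 2 * (x / 2) ^ P.natDegree := by
      rw [div_pow]; field_simp
    rw [h3, eq_neg_of_add_eq_zero_right h0, mul_neg, Finset.mul_sum]
    congr 1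
    refine Finset.sum_congr rfl fun i hi ↦ ?_
    obtain ⟨k, hk⟩ := Nat.exists_eq_add_of_lt (Finset.mem_range.mp hi)
    rw [hk, show i + k + 1 - i - 1 = k by lia, div_pow]
    field_simp
    ring
  rw [h1]
  exact neg_mem (sum_mem fun i _ ↦ mul_mem (mul_mem (algebraMap_mem _ _) (pow_mem hx _))
    (pow_mem (ofNat_mem B 2) _))

lemma TwoRadical.twoClosed [NeZero (2 : K)] {B : Subalgebra S K} (hB : TwoRadical B) :
    TwoClosed B := fun _ hx h ↦
  hB.of_pow hx (h.exists_pow_div_two_mem hx).choose_spec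

lemma sub_pow_div_two_mem {B : Subalgebra S K} {x y : K} (hx : x ∈ B) (hy : y ∈ B)
    (h : (x - y) / 2 ∈ B) (n : ℕ) : (x ^ n - y ^ n) / 2 ∈ B := by
  induction n with
  | zero => simp
  | succ n ih =>
    have : (x ^ (n + 1) - y ^ (n + 1)) / 2 = x * ((x ^ n - y ^ n) / 2) + (x - y) / 2 * y ^ n := by
      ring
    rw [this]
    exact add_mem (mul_mem hx ih) (mul_mem h (pow_mem hy n))

/-- `A = B ⊕ B t`. -/
structure IsQuadraticOver (A B : Subalgebra S K) (t : K) : Prop where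
  mem_iff : ∀ x, x ∈ A ↔ ∃ u ∈ B, ∃ v ∈ B, x = u + v * t
  eq_zero : ∀ u ∈ B, ∀ v ∈ B, u + v * t = 0 → u = 0 ∧ v = 0

namespace IsQuadraticOver

variable {A B : Subalgebra S K} {t : K}

lemma le (h : IsQuadraticOver A B t) : B ≤ A := fun x hx ↦
  (h.mem_iff x).mpr ⟨x, hx, 0, zero_mem _, by ring⟩

lemma mem (h : IsQuadraticOver A B t) : t ∈ A :=
  (h.mem_iff t).mpr ⟨0, zero_mem _, 1, one_mem _, by ring⟩

/-- Allows the generator ω or μ to be replaced by its translate satisfying an Eisenstein polynomial.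
-/
lemma add_right (h : IsQuadraticOver A B t) {c : K} (hc : c ∈ B) :
    IsQuadraticOver A B (t + c) where
  mem_iff x := by
    rw [h.mem_iff]
    constructor
    · rintro ⟨u, hu, v, hv, rfl⟩
      exact ⟨_, sub_mem hu (mul_mem hv hc), v, hv, by ring⟩
    · rintro ⟨u, hu, v, hv, rfl⟩
      exact ⟨_, add_mem hu (mul_mem hv hc), v, hv, by ring⟩
  eq_zero u hu v hv h0 := by
    obtain ⟨h1, h2⟩ := h.eq_zero (u + v * c) (add_mem hu (mul_mem hv hc)) v hv (by rw [← h0]; ring)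
    exact ⟨by simpa [h2] using h1, h2⟩

variable [NeZero (2 : K)]

/-- Uniqueness of coordinates gives 2A = 2B ⊕ 2Bt, so divisibility by 2 is tested coordinatewise. -/
lemma div_two_mem (h : IsQuadraticOver A B t) {u v : K} (hu : u ∈ B) (hv : v ∈ B)
    (h2 : (u + v * t) / 2 ∈ A) : u / 2 ∈ B ∧ v / 2 ∈ B := by
  have h20 : (2 : K) ≠ 0 := NeZero.ne _
  obtain ⟨u', hu', v', hv', he⟩ := (h.mem_iff _).mp h2
  have he' : u + v * t = 2 * (u' + v' * t) := by rw [← he]; field_simp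
  obtain ⟨h3, h4⟩ := h.eq_zero (u - 2 * u') (sub_mem hu (mul_mem (ofNat_mem B 2) hu')) (v - 2 * v')
    (sub_mem hv (mul_mem (ofNat_mem B 2) hv')) (by linear_combination he')
  rw [sub_eq_zero.mp h3, sub_eq_zero.mp h4, mul_div_cancel_left₀ _ h20, mul_div_cancel_left₀ _ h20]
  exact ⟨hu', hv'⟩

lemma div_two_mem_of_mem (h : IsQuadraticOver A B t) {u : K} (hu : u ∈ B) (h2 : u / 2 ∈ A) :
    u / 2 ∈ B :=
  (h.div_two_mem hu (zero_mem _) (by simpa using h2)).1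

lemma twoRegular (h : IsQuadraticOver A B t) {c : K} (hc : c ∈ B) (hreg : TwoRegular B c) :
    TwoRegular A c := by
  intro x hx h2
  obtain ⟨u, hu, v, hv, rfl⟩ := (h.mem_iff _).mp hx
  obtain ⟨h3, h4⟩ := h.div_two_mem (mul_mem hc hu) (mul_mem hc hv) (by convert h2 using 1; ring)
  exact (h.mem_iff _).mpr ⟨_, hreg u hu h3, _, hreg v hv h4, by ring⟩

/-- If the discriminant of `t` is regular modulo `2`, adjoining `t` keeps `2` radical. -/
lemma twoRadical (h : IsQuadraticOver A B t) {p q : K} (hp : p ∈ B) (hq : q ∈ B)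
    (ht : t ^ 2 = p * t + q) (hreg : TwoRegular B p) (hB : TwoRadical B) : TwoRadical A := by
  have h20 : (2 : K) ≠ 0 := NeZero.ne _
  intro x hx h2
  obtain ⟨u, hu, v, hv, rfl⟩ := (h.mem_iff _).mp hx
  -- Modulo 2A the cross term of (u + vt)² vanishes, leaving the coordinates u² + v²q and pv².
  obtain ⟨h3, h4⟩ := h.div_two_mem (add_mem (pow_mem hu 2) (mul_mem (pow_mem hv 2) hq))
    (mul_mem hp (pow_mem hv 2)) (by
      have : (u ^ 2 + v ^ 2 * q + p * v ^ 2 * t) / 2 = (u + v * t) ^ 2 / 2 - u * (v * t) := by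
        field_simp; linear_combination (-v ^ 2) * ht
      rw [this]
      exact sub_mem h2 (mul_mem (h.le hu) (mul_mem (h.le hv) h.mem)))
  have hv2 := hreg _ (pow_mem hv 2) h4
  have hu2 : u ^ 2 / 2 ∈ B := by
    have : u ^ 2 / 2 = (u ^ 2 + v ^ 2 * q) / 2 - v ^ 2 / 2 * q := by ring
    rw [this]
    exact sub_mem h3 (mul_mem hv2 hq)
  exact (h.mem_iff _).mpr ⟨_, hB u hu hu2, _, hB v hv hv2, by ring⟩

/-- If `t` satisfies an Eisenstein polynomial at `2`, adjoining `t` keeps the ring closed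
at `2`. -/
lemma twoClosed (h : IsQuadraticOver A B t) {p q : K} (hp : p ∈ B) (hq : q ∈ B)
    (ht : t ^ 2 = 2 * p * t + 2 * q) (hreg : TwoRegular B q) (hB : TwoRadical B)
    (hint : ∀ x ∈ B, IsIntegral S x) : TwoClosed A := by
  have h20 : (2 : K) ≠ 0 := NeZero.ne _
  -- Integrality of x/2 makes x nilpotent modulo 2A. As x² ≡ w², so is w, and radicality of 2B then
  -- gives w/2 ∈ B.
  have key {x w : K} (hx : x ∈ A) (hw : w ∈ B) (hxw : (x ^ 2 - w ^ 2) / 2 ∈ A)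
      (hi : IsIntegral S (x / 2)) : w / 2 ∈ B := by
    obtain ⟨n, hn⟩ := hi.exists_pow_div_two_mem hx
    refine hB.of_pow hw (n := 2 * n) (h.div_two_mem_of_mem (pow_mem hw _) ?_)
    have : w ^ (2 * n) / 2 = x ^ n / 2 * x ^ n - ((x ^ 2) ^ n - (w ^ 2) ^ n) / 2 := by ring
    rw [this]
    exact sub_mem (mul_mem hn (pow_mem hx n))
      (sub_pow_div_two_mem (pow_mem hx 2) (pow_mem (h.le hw) 2) hxw n)
  intro x hx hi
  obtain ⟨u, hu, v, hv, rfl⟩ := (h.mem_iff _).mp hx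
  have hu' := h.le hu
  have hv' := h.le hv
  have hp' := h.le hp
  have hq' := h.le hq
  have htA := h.mem
  -- Since t² ∈ 2A, (u + vt)² ≡ u² modulo 2A.
  have hu2 : u / 2 ∈ B := key hx hu (by
    have : ((u + v * t) ^ 2 - u ^ 2) / 2 = u * v * t + v ^ 2 * (p * t + q) := by
      field_simp; linear_combination v ^ 2 * ht
    rw [this]
    exact add_mem (mul_mem (mul_mem hu' hv') htA)
      (mul_mem (pow_mem hv' 2) (add_mem (mul_mem hp' htA) hq'))) hi
  -- With u/2 removed, vt/2 is integral; its square is v²t²/4 = v²(pt + q)/2. Applying `key` once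
  -- more gives qv²/2 ∈ B, from which regularity of q and radicality yield v/2 ∈ B.
  have hi2 : IsIntegral S (v ^ 2 * (p * t + q) / 2) := by
    have : v ^ 2 * (p * t + q) / 2 = ((u + v * t) / 2 - u / 2) ^ 2 := by
      field_simp; linear_combination (-v ^ 2) * ht
    rw [this]
    exact (hi.sub (hint _ hu2)).pow 2
  have hv2 : q * v ^ 2 / 2 ∈ B := key (mul_mem (pow_mem hv' 2) (add_mem (mul_mem hp' htA) hq'))
    (mul_mem hq (pow_mem hv 2)) (by
      have : ((v ^ 2 * (p * t + q)) ^ 2 - (q * v ^ 2) ^ 2) / 2 =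
          v ^ 4 * (p ^ 2 * (p * t + q) + p * q * t) := by
        field_simp; linear_combination v ^ 4 * p ^ 2 * ht
      rw [this]
      exact mul_mem (pow_mem hv' 4) (add_mem (mul_mem (pow_mem hp' 2) (add_mem (mul_mem hp' htA) hq'))
        (mul_mem (mul_mem hp' hq') htA))) hi2
  exact (h.mem_iff _).mpr ⟨_, hu2, _, hB v hv (hreg _ (pow_mem hv 2) hv2), by ring⟩

end IsQuadraticOver

lemma algebraMap_div_two_mem_bot_iff (hinj : Function.Injective (algebraMap S K)) [NeZero (2 : K)]
    (s : S) : algebraMap S K s / 2 ∈ (⊥ : Subalgebra S K) ↔ 2 ∣ s := by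
  have h20 : (2 : K) ≠ 0 := NeZero.ne _
  rw [Algebra.mem_bot]
  constructor
  · rintro ⟨c, hc⟩
    refine ⟨c, hinj ?_⟩
    rw [map_mul, hc, map_ofNat]; field_simp
  · rintro ⟨c, rfl⟩
    exact ⟨c, by rw [map_mul, map_ofNat]; field_simp⟩

lemma twoRadical_bot (hinj : Function.Injective (algebraMap S K)) [NeZero (2 : K)]
    (h2 : Prime (2 : S)) : TwoRadical (⊥ : Subalgebra S K) := by
  intro x hx h
  obtain ⟨s, rfl⟩ := Algebra.mem_bot.mp hx
  rw [← map_pow, algebraMap_div_two_mem_bot_iff hinj] at h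
  exact (algebraMap_div_two_mem_bot_iff hinj s).mpr (h2.dvd_of_dvd_pow h)

lemma twoRegular_bot (hinj : Function.Injective (algebraMap S K)) [NeZero (2 : K)]
    (h2 : Prime (2 : S)) {c : S} (hc : ¬ 2 ∣ c) :
    TwoRegular (⊥ : Subalgebra S K) (algebraMap S K c) := by
  intro x hx h
  obtain ⟨s, rfl⟩ := Algebra.mem_bot.mp hx
  rw [← map_mul, algebraMap_div_two_mem_bot_iff hinj] at h
  exact (algebraMap_div_two_mem_bot_iff hinj s).mpr ((h2.dvd_or_dvd h).resolve_left hc)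

end Two

/-! ### Regular local rings -/

open IsLocalRing in
/-- If `x ∈ 𝔪 \ 𝔪²`, the maximal ideal of `R ⧸ (x)` needs fewer generators than `𝔪`. -/
lemma IsLocalRing.spanFinrank_maximalIdeal_quotient_lt {R : Type*} [CommRing R] [IsLocalRing R]
    [IsNoetherianRing R] {x : R} (hx : x ∈ maximalIdeal R) (hx2 : x ∉ maximalIdeal R ^ 2)
    [IsLocalRing (R ⧸ Ideal.span {x})] :
    (maximalIdeal (R ⧸ Ideal.span {x})).spanFinrank + 1 ≤ (maximalIdeal R).spanFinrank := by
  classical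
  have fg := (maximalIdeal R).fg_of_isNoetherianRing
  have fin := Submodule.FG.finite_generators fg
  lift (maximalIdeal R).generators to Finset R using fin with G hG
  have hspan : Ideal.span (G : Set R) = maximalIdeal R := by
    rw [hG]; exact (maximalIdeal R).span_generators
  have hcard : G.card = (maximalIdeal R).spanFinrank := by
    rw [← Submodule.FG.generators_ncard fg, ← hG, Set.ncard_coe_finset]
  obtain ⟨c, -, hc⟩ := Submodule.mem_span_finset.mp (hspan.ge hx)
  -- Since x ∉ 𝔪², some coefficient of x on the minimal generators is a unit, and that generator is
  -- redundant modulo x.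
  obtain ⟨a, ha, hca⟩ : ∃ a ∈ G, IsUnit (c a) := by
    by_contra! h
    refine hx2 (hc ▸ sum_mem fun a ha ↦ ?_)
    rw [pow_two]
    exact Ideal.mul_mem_mul ((mem_maximalIdeal _).mpr (h a ha)) (hspan.le (Ideal.subset_span ha))
  have hsurj := Ideal.Quotient.mk_surjective (I := Ideal.span {x})
  have hm : maximalIdeal (R ⧸ Ideal.span {x}) =
      Ideal.span (Ideal.Quotient.mk (Ideal.span {x}) '' (G.erase a : Set R)) := by
    have h1 : maximalIdeal (R ⧸ Ideal.span {x}) =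
        (maximalIdeal R).map (Ideal.Quotient.mk (Ideal.span {x})) :=
      (map_maximalIdeal_of_surjective _ hsurj).symm
    rw [h1, ← hspan, Ideal.map_span]
    refine le_antisymm (Ideal.span_le.mpr ?_) (Ideal.span_mono (Set.image_mono (by simp)))
    rintro _ ⟨y, hy, rfl⟩
    by_cases hya : y = a
    · subst hya
      have h2 : c y • y = x - ∑ z ∈ G.erase y, c z • z := by
        rw [← hc, ← Finset.add_sum_erase G _ ha]; ring
      have h3 := congrArg (Ideal.Quotient.mk (Ideal.span {x})) h2
      rw [smul_eq_mul, map_mul, map_sub, Ideal.Quotient.eq_zero_iff_mem.mpr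
        (Ideal.mem_span_singleton_self x), zero_sub, map_sum] at h3
      refine (Ideal.unit_mul_mem_iff_mem _ (hca.map (Ideal.Quotient.mk (Ideal.span {x})))).mp ?_
      rw [h3]
      refine neg_mem (sum_mem fun z hz ↦ ?_)
      rw [smul_eq_mul, map_mul]
      exact Ideal.mul_mem_left _ _ (Ideal.subset_span ⟨z, hz, rfl⟩)
    · exact Ideal.subset_span ⟨y, by simp_all, rfl⟩
  rw [hm, ← hcard, ← Finset.card_erase_add_one ha, add_le_add_iff_right]
  refine (Submodule.spanFinrank_span_le_ncard_of_finite ((G.erase a).finite_toSet.image _)).trans ?_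
  exact (Set.ncard_image_le (G.erase a).finite_toSet).trans (Set.ncard_coe_finset _).le

open IsLocalRing RingTheory.Sequence Pointwise in
/-- A regular local ring is a domain whose maximal ideal is generated by a regular sequence. -/
theorem IsRegularLocalRing.isDomain_and_exists_isWeaklyRegular (d : ℕ) (R : Type*) [CommRing R]
    [IsRegularLocalRing R] (hd : (maximalIdeal R).spanFinrank = d) :
    IsDomain R ∧ ∃ rs : List R, IsWeaklyRegular R rs ∧ Ideal.ofList rs = maximalIdeal R := by
  have fg := (maximalIdeal R).fg_of_isNoetherianRing
  have hdim := (isRegularLocalRing_iff R).mp ‹_›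
  induction d generalizing R with
  | zero =>
    have hbot : maximalIdeal R = ⊥ := (Submodule.spanFinrank_eq_zero_iff_eq_bot fg).mp hd
    exact ⟨(isField_iff_maximalIdeal_eq.mpr hbot).isDomain, [], .nil R R, by simp [hbot]⟩
  | succ d ih =>
    have hne : maximalIdeal R ≠ ⊥ := fun h ↦ by
      rw [(Submodule.spanFinrank_eq_zero_iff_eq_bot fg).mpr h] at hd; lia
    have hsq : ¬ maximalIdeal R ≤ maximalIdeal R ^ 2 := fun h ↦ hne <|
      Submodule.eq_bot_of_le_smul_of_le_jacobson_bot (maximalIdeal R) _ fg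
        (by rwa [smul_eq_mul, ← pow_two]) (maximalIdeal_le_jacobson _)
    have hmin (p : Ideal R) (hp : p ∈ minimalPrimes R) : ¬ maximalIdeal R ≤ p := fun h ↦ by
      have := hp.1.1
      have h0 : maximalIdeal R ∈ minimalPrimes R := le_antisymm h (le_maximalIdeal hp.1.1.ne_top) ▸ hp
      rw [← Ideal.height_eq_zero_iff] at h0
      rw [hd, ← maximalIdeal_height_eq_ringKrullDim, h0] at hdim
      norm_cast at hdim
    obtain ⟨x, hx, hx2, hxmin⟩ : ∃ x ∈ maximalIdeal R, x ∉ maximalIdeal R ^ 2 ∧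
        ∀ p ∈ minimalPrimes R, x ∉ p := by
      by_contra! h
      -- Prime avoidance tolerates two ideals that are not prime; 𝔪² fills both places.
      have := (Ideal.subset_union_prime_finite
        ((minimalPrimes.finite_of_isNoetherianRing R).insert (maximalIdeal R ^ 2))
        (f := id) (maximalIdeal R ^ 2) (maximalIdeal R ^ 2)
        (fun i hi hi1 _ ↦ ((Set.mem_insert_iff.mp hi).resolve_left hi1).1.1)
        (I := maximalIdeal R)).mp fun x hx ↦ by
          by_cases hx2 : x ∈ maximalIdeal R ^ 2
          · exact Set.mem_biUnion (Set.mem_insert _ _) hx2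
          · obtain ⟨p, hp, hxp⟩ := h x hx hx2
            exact Set.mem_biUnion (Set.mem_insert_of_mem _ hp) hxp
      obtain ⟨i, rfl | hi, hle⟩ := this
      · exact hsq hle
      · exact hmin i hi hle
    have hxtop : Ideal.span {x} ≠ ⊤ := fun h ↦
      (mem_maximalIdeal x).mp hx (Ideal.span_singleton_eq_top.mp h)
    have : Nontrivial (R ⧸ Ideal.span {x}) := Ideal.Quotient.nontrivial_iff.mpr hxtop
    have hsurj := Ideal.Quotient.mk_surjective (I := Ideal.span {x})
    have : IsLocalRing (R ⧸ Ideal.span {x}) := .of_surjective' _ hsurj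
    have hle := spanFinrank_maximalIdeal_quotient_lt hx hx2
    have hxsp : x • (⊤ : Ideal R) = Ideal.span {x} := by
      rw [← Submodule.ideal_span_singleton_smul]; simp
    have hdimle : (d : WithBot ℕ∞) ≤ ringKrullDim (R ⧸ Ideal.span {x}) := by
      have := ringKrullDim_le_ringKrullDim_quotSMulTop_succ hx
      rw [hxsp, ← hdim, hd] at this
      push_cast at this
      exact (ENat.WithBot.add_le_add_one_right_iff).mp this
    have hreg : IsRegularLocalRing (R ⧸ Ideal.span {x}) :=
      .of_spanFinrank_maximalIdeal_le _ ((Nat.cast_le.mpr (by lia)).trans hdimle)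
    have hdim' := (isRegularLocalRing_iff (R ⧸ Ideal.span {x})).mp hreg
    have hd' : (maximalIdeal (R ⧸ Ideal.span {x})).spanFinrank = d := by
      refine le_antisymm (by lia) ?_
      rw [← hdim'] at hdimle
      exact_mod_cast hdimle
    obtain ⟨hdom, rs', hrs', hspan'⟩ := ih (R ⧸ Ideal.span {x}) hd'
      (maximalIdeal (R ⧸ Ideal.span {x})).fg_of_isNoetherianRing hdim'
    have hprime : (Ideal.span {x}).IsPrime := (Ideal.Quotient.isDomain_iff_prime _).mp hdom
    obtain ⟨p, hp, hpx⟩ := Ideal.exists_minimalPrimes_le (bot_le : ⊥ ≤ Ideal.span {x})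
    -- As p ⊆ (x) and x ∉ p, every element of p is x times an element of p, so Nakayama gives p = 0.
    have hp0 : p = ⊥ := by
      refine Submodule.eq_bot_of_le_smul_of_le_jacobson_bot (maximalIdeal R) _
        p.fg_of_isNoetherianRing (fun y hy ↦ ?_) (maximalIdeal_le_jacobson _)
      obtain ⟨r, rfl⟩ := Ideal.mem_span_singleton.mp (hpx hy)
      exact Submodule.smul_mem_smul hx ((hp.1.1.mem_or_mem hy).resolve_left (hxmin p hp))
    have hR : IsDomain R := by
      have := hp.1.1
      rw [hp0] at this
      exact IsDomain.of_bot_isPrime R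
    obtain ⟨rs, rfl⟩ := List.map_surjective_iff.mpr hsurj rs'
    refine ⟨hR, x :: rs, .cons ?_ ?_, ?_⟩
    · have hx0 : x ≠ 0 := fun h ↦ hxmin p hp (h ▸ p.zero_mem)
      exact fun a b hab ↦ mul_left_cancel₀ hx0 hab
    · rw [(Submodule.quotEquivOfEq _ _ hxsp :
        QuotSMulTop x R ≃ₗ[R] R ⧸ Ideal.span {x}).isWeaklyRegular_congr]
      exact (isWeaklyRegular_map_algebraMap_iff (R ⧸ Ideal.span {x}) (R ⧸ Ideal.span {x}) rs).mp hrs'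
    · rw [Ideal.ofList_cons, ← Ideal.mk_ker (I := Ideal.span {x}), sup_comm, ← Ideal.comap_map_of_surjective' _ hsurj, Ideal.map_ofList, hspan']
      have := IsLocalHom.of_surjective _ hsurj
      exact maximalIdeal_comap (Ideal.Quotient.mk (Ideal.span {x}))

/-! ### Cohen–Macaulayness of finite flat algebras -/

open IsLocalRing RingTheory.Sequence in
/-- A finite flat algebra over a regular ring is Cohen-Macaulay. -/
theorem IsRegularAtMaximals.isCohenMacaulay_of_finite_of_flat {S R : Type*} [CommRing S] [CommRing R]
    [Algebra S R] [Module.Finite S R] [Module.Flat S R] (hS : IsRegularAtMaximals S) :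
    IsCohenMacaulay R := by
  have := hS.1
  have hR : IsNoetherianRing R := IsNoetherianRing.of_finite S R
  refine ⟨hR, fun m hm ↦ ⟨inferInstance, ?_⟩⟩
  set n := m.comap (algebraMap S R) with hn
  have hnmax : n.IsMaximal := Ideal.isMaximal_comap_of_isIntegral_of_isMaximal m
  have := hS.2 n
  obtain ⟨-, rs, hrs, hspan⟩ :=
    IsRegularLocalRing.isDomain_and_exists_isWeaklyRegular _ (Localization.AtPrime n) rfl
  set φ := Localization.localRingHom n m (algebraMap S R) rfl with hφ
  have hloc : IsLocalHom φ := Localization.isLocalHom_localRingHom n m _ rfl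
  have hflat : φ.Flat := RingHom.Flat.localRingHom
    (RingHom.flat_algebraMap_iff.mpr inferInstance) m n rfl
  let _ := φ.toAlgebra
  have : Module.Flat (Localization.AtPrime n) (Localization.AtPrime m) := hflat
  have hmem : ∀ r ∈ rs.map φ, r ∈ maximalIdeal (Localization.AtPrime m) := by
    intro r hr
    obtain ⟨s, hs, rfl⟩ := List.mem_map.mp hr
    exact ((mem_maximalIdeal _).mpr ((map_mem_nonunits_iff φ s).mpr
      ((mem_maximalIdeal s).mp (hspan ▸ Ideal.subset_span hs))))
  have hreg : IsRegular (Localization.AtPrime m) (rs.map φ) :=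
    .of_isWeaklyRegular_of_mem_maximalIdeal _ hmem (IsWeaklyRegular.of_flat hrs)
  -- Such a P contracts to a prime of R inside m and lying over the maximal ideal n. Integrality
  -- makes this prime maximal, hence equal to m.
  have hprimes (P : Ideal (Localization.AtPrime m)) (hP : P.IsPrime)
      (hle : Ideal.ofList (rs.map φ) ≤ P) : P = maximalIdeal _ := by
    set p := P.comap (algebraMap R (Localization.AtPrime m)) with hp
    have hpm : p ≤ m := by
      have h1 := Ideal.comap_mono (f := algebraMap R (Localization.AtPrime m))
        (le_maximalIdeal hP.ne_top)
      exact h1.trans_eq Localization.AtPrime.under_maximalIdeal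
    have hnp : n ≤ p.comap (algebraMap S R) := fun s hs ↦ by
      have h1 : algebraMap S (Localization.AtPrime n) s ∈ Ideal.ofList rs := by
        rw [hspan, ← Localization.AtPrime.map_eq_maximalIdeal]
        exact Ideal.mem_map_of_mem _ hs
      have h2 := Ideal.mem_map_of_mem φ h1
      rw [Ideal.map_ofList, hφ, Localization.localRingHom_to_map] at h2
      exact hle h2
    have hpp : p.IsPrime := hP.comap _
    have hpmax : p.IsMaximal := by
      refine Ideal.isMaximal_of_isIntegral_of_isMaximal_comap (R := S) p ?_
      rwa [← hnmax.eq_of_le (hpp.comap _).ne_top hnp]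
    have hPp : p.map (algebraMap R (Localization.AtPrime m)) = P :=
      IsLocalization.map_under m.primeCompl _ P
    rw [← hPp, hpmax.eq_of_le hm.ne_top hpm, Localization.AtPrime.map_eq_maximalIdeal]
  have hrad : (Ideal.ofList (rs.map φ)).radical = maximalIdeal (Localization.AtPrime m) := by
    refine le_antisymm ((maximalIdeal.isMaximal _).isPrime.radical_le_iff.mpr
      (Ideal.span_le.mpr hmem)) ?_
    rw [Ideal.radical_eq_sInf]
    exact le_sInf fun P hP ↦ (hprimes P hP.2 hP.1).ge
  refine ⟨rs.map φ, ⟨?_, hrad⟩, hreg⟩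
  -- The sequence has length equal to the dimension once the quotient by it is known to have
  -- dimension zero.
  rw [← ringKrullDim_add_length_eq_ringKrullDim_of_isRegular _ hreg]
  have : Nontrivial (Localization.AtPrime m ⧸ Ideal.ofList (rs.map φ)) :=
    Ideal.Quotient.nontrivial_iff.mpr fun h ↦
      (maximalIdeal.isMaximal _).ne_top (top_le_iff.mp (h.ge.trans (Ideal.span_le.mpr hmem)))
  have : Ring.KrullDimLE 0 (Localization.AtPrime m ⧸ Ideal.ofList (rs.map φ)) := by
    have hsurj := Ideal.Quotient.mk_surjective (I := Ideal.ofList (rs.map φ))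
    refine .mk₀ fun I hI ↦ ?_
    have h1 := hprimes (I.comap (Ideal.Quotient.mk _)) (hI.comap _) (Ideal.mk_ker.ge.trans
      (Ideal.ker_le_comap _))
    have h2 := Ideal.map_comap_of_surjective _ hsurj I
    rw [h1] at h2
    rw [← h2]
    exact (Ideal.map_eq_top_or_isMaximal_of_surjective _ hsurj
      (maximalIdeal.isMaximal _)).resolve_left fun h ↦ hI.ne_top (h2.symm.trans h)
  rw [ringKrullDimZero_iff_ringKrullDim_eq_zero.mp this, zero_add]

/-! ### Biquadratic field extensions -/

open IntermediateField in
/-- `K = L(ω, μ)` with `ω ∉ L` and `μ ∉ L(ω)`. -/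
structure IsBiquadratic (L : Type*) {K : Type*} [Field L] [Field K] [Algebra L K] (ω μ : K) :
    Prop where
  notMem_bot : ω ∉ (⊥ : IntermediateField L K)
  notMem_adjoin : μ ∉ L⟮ω⟯
  adjoin_eq_top : IntermediateField.adjoin L {ω, μ} = ⊤

section Field

open IntermediateField

variable {L K : Type*} [Field L] [Field K] [Algebra L K]

lemma isIntegral_of_sq_eq_algebraMap {R A : Type*} [CommRing R] [CommRing A] [Algebra R A] {ω : A}
    {f : R} (hω : ω ^ 2 = algebraMap R A f) : IsIntegral R ω :=
  .of_pow two_pos (hω ▸ isIntegral_algebraMap)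

lemma IntermediateField.mem_adjoin_simple_iff_of_sq_eq {ω : K} {f : L}
    (hω : ω ^ 2 = algebraMap L K f) (x : K) :
    x ∈ L⟮ω⟯ ↔ ∃ c d, x = algebraMap L K c + algebraMap L K d * ω := by
  rw [← mem_toSubalgebra, adjoin_simple_toSubalgebra_of_isAlgebraic
    (isIntegral_of_sq_eq_algebraMap hω).isAlgebraic]
  exact Algebra.mem_adjoin_singleton_iff_of_sq_eq (p := 0) (q := f) (by simp [hω]) x

lemma IsBiquadratic.exists_eq_add_mul {ω μ : K} (h : IsBiquadratic L ω μ) {f g : L}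
    (hω : ω ^ 2 = algebraMap L K f) (hμ : μ ^ 2 = algebraMap L K g) (x : K) :
    ∃ u ∈ L⟮ω⟯, ∃ v ∈ L⟮ω⟯, x = u + v * μ := by
  have hx : x ∈ (IntermediateField.adjoin L {ω, μ}).toSubalgebra := by simp [h.adjoin_eq_top]
  rw [adjoin_toSubalgebra_of_isAlgebraic, Set.pair_comm,
    Algebra.mem_adjoin_insert_iff_of_sq_eq (zero_mem _) (algebraMap_mem _ g) (by simp [hμ])] at hx
  · obtain ⟨u, hu, v, hv, rfl⟩ := hx
    exact ⟨u, algebra_adjoin_le_adjoin L _ hu, v, algebra_adjoin_le_adjoin L _ hv, rfl⟩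
  · rintro y (rfl | rfl)
    · exact (isIntegral_of_sq_eq_algebraMap hω).isAlgebraic
    · exact (isIntegral_of_sq_eq_algebraMap hμ).isAlgebraic

/-- If ω = c + dμ, squaring gives 2cdμ ∈ L. So d = 0 and ω ∈ L, or c = 0 and μ = ω/d, or μ ∈ L; each
is excluded. -/
lemma IsBiquadratic.symm {ω μ : K} (h : IsBiquadratic L ω μ) [NeZero (2 : L)] {f g : L}
    (hω : ω ^ 2 = algebraMap L K f) (hμ : μ ^ 2 = algebraMap L K g) : IsBiquadratic L μ ω where
  notMem_bot h' := h.notMem_adjoin ((bot_le : (⊥ : IntermediateField L K) ≤ L⟮ω⟯) h')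
  notMem_adjoin h' := by
    obtain ⟨c, d, hcd⟩ := (mem_adjoin_simple_iff_of_sq_eq hμ ω).mp h'
    have h20 : (2 : L) ≠ 0 := NeZero.ne _
    have hμ' : μ ∉ (⊥ : IntermediateField L K) := fun h' ↦
      h.notMem_adjoin ((bot_le : (⊥ : IntermediateField L K) ≤ L⟮ω⟯) h')
    by_cases hd : d = 0
    · exact h.notMem_bot (mem_bot.mpr ⟨c, by simp [hcd, hd]⟩)
    by_cases hc : c = 0
    · refine h.notMem_adjoin ((mem_adjoin_simple_iff_of_sq_eq hω μ).mpr ⟨0, d⁻¹, ?_⟩)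
      have : algebraMap L K d ≠ 0 := by simpa using hd
      rw [hcd, hc, map_inv₀]; field_simp; simp
    · refine hμ' (mem_bot.mpr ⟨(f - c ^ 2 - d ^ 2 * g) / (2 * c * d), ?_⟩)
      have h0 : algebraMap L K (2 * c * d) ≠ 0 := by simp [hd, hc, h20]
      rw [map_div₀, div_eq_iff h0]
      simp only [map_sub, map_mul, map_pow, map_ofNat, ← hω, ← hμ, hcd]
      ring
  adjoin_eq_top := by rw [Set.pair_comm]; exact h.adjoin_eq_top

end Field

/-! ### Bounding denominators of integral elements by 4 -/

section Integral

open IntermediateField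

variable {S L K : Type*} [CommRing S] [IsDomain S] [IsNoetherianRing S] [IsIntegrallyClosed S]
  [Field L] [CharZero L] [Algebra S L] [IsFractionRing S L]
  [Field K] [Algebra L K] [Algebra S K] [IsScalarTower S L K]

-- The square y²r of yρ is integral and lies in L, hence in S; square freeness of r then removes the
-- denominator of y.
omit [CharZero L] in
lemma IsSquareFreeElt.exists_algebraMap_eq_of_isIntegral_mul {r : S} (hr : IsSquareFreeElt r) {ρ : K}
    (hρ : ρ ^ 2 = algebraMap S K r) {y : L} (h : IsIntegral S (algebraMap L K y * ρ)) :
    ∃ s, algebraMap S L s = y := by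
  refine hr.mem_range_of_sq_mul_mem (IsIntegrallyClosed.isIntegral_iff.mp ?_)
  refine (isIntegral_algebraMap_iff (algebraMap L K).injective).mp ?_
  rw [map_mul, map_pow, ← IsScalarTower.algebraMap_apply, ← hρ, ← mul_pow]
  exact h.pow 2

-- These are the sum and the difference of u + vμ and its conjugate u - vμ.
omit [IsDomain S] [IsNoetherianRing S] [IsIntegrallyClosed S] [CharZero L] [IsFractionRing S L] in
lemma IsIntegral.add_sub_of_notMem {E : IntermediateField L K} {μ : K} (hμ2 : μ ^ 2 ∈ E)
    (hμ : μ ∉ E) {u v : K} (hu : u ∈ E) (hv : v ∈ E) (h : IsIntegral S (u + v * μ)) :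
    IsIntegral S (2 * u) ∧ IsIntegral S (2 * (v * μ)) := by
  let _ : Algebra S E := ((algebraMap L E).comp (algebraMap S L)).toAlgebra
  have : IsScalarTower S E K := .of_algebraMap_eq fun s ↦ IsScalarTower.algebraMap_apply S L K s
  have h' : IsIntegral S (u - v * μ) := IsIntegral.sub_mul_of_sq_eq (S := S) (E := E)
    (g := ⟨_, hμ2⟩) (u := ⟨u, hu⟩) (v := ⟨v, hv⟩) (μ := μ) rfl (fun e he ↦ hμ (he ▸ e.2)) h
  constructor
  · rw [show 2 * u = u + v * μ + (u - v * μ) by ring]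
    exact h.add h'
  · rw [show 2 * (v * μ) = u + v * μ - (u - v * μ) by ring]
    exact h.sub h'

omit [CharZero L] in
lemma IsSquareFreeElt.two_mul_mem_of_isIntegral_add_mul {f : S} (hf : IsSquareFreeElt f) {ω : K}
    (hω : ω ^ 2 = algebraMap S K f) (hnot : ω ∉ (⊥ : IntermediateField L K)) {c d : L}
    (h : IsIntegral S (algebraMap L K c + algebraMap L K d * ω)) :
    (∃ s, algebraMap S L s = 2 * c) ∧ ∃ s, algebraMap S L s = 2 * d := by
  obtain ⟨h1, h2⟩ := h.add_sub_of_notMem (E := ⊥)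
    (by rw [hω, IsScalarTower.algebraMap_apply S L K]; exact IntermediateField.algebraMap_mem _ _) hnot
    (IntermediateField.algebraMap_mem _ _) (IntermediateField.algebraMap_mem _ _)
  constructor
  · refine IsIntegrallyClosed.isIntegral_iff.mp
      ((isIntegral_algebraMap_iff (algebraMap L K).injective).mp ?_)
    rwa [map_mul, map_ofNat]
  · refine hf.exists_algebraMap_eq_of_isIntegral_mul hω ?_
    rwa [map_mul, map_ofNat, mul_assoc]

lemma IsBiquadratic.four_mul_mem {f g : S} (hf : IsSquareFreeElt f) (hg : IsSquareFreeElt g)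
    (hfg : NoCommonHeightOnePrime f g) {ω μ : K} (h : IsBiquadratic L ω μ)
    (hω : ω ^ 2 = algebraMap S K f) (hμ : μ ^ 2 = algebraMap S K g) {A : Subalgebra S K}
    (hωA : ω ∈ A) (hμA : μ ∈ A) {x : K} (hx : IsIntegral S x) : 2 * (2 * x) ∈ A := by
  have hωL : ω ^ 2 = algebraMap L K (algebraMap S L f) := by
    rw [hω, IsScalarTower.algebraMap_apply S L K]
  have hμL : μ ^ 2 = algebraMap L K (algebraMap S L g) := by
    rw [hμ, IsScalarTower.algebraMap_apply S L K]
  obtain ⟨u, hu, v, hv, rfl⟩ := h.exists_eq_add_mul hωL hμL x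
  obtain ⟨h1, h2⟩ := hx.add_sub_of_notMem (by rw [hμL]; exact IntermediateField.algebraMap_mem _ _) h.notMem_adjoin hu hv
  obtain ⟨c₀, c₁, rfl⟩ := (mem_adjoin_simple_iff_of_sq_eq hωL u).mp hu
  obtain ⟨c₂, c₃, rfl⟩ := (mem_adjoin_simple_iff_of_sq_eq hωL v).mp hv
  obtain ⟨⟨s₀, hs₀⟩, s₁, hs₁⟩ := hf.two_mul_mem_of_isIntegral_add_mul hω h.notMem_bot
    (c := 2 * c₀) (d := 2 * c₁) (by convert h1 using 1; simp only [map_mul, map_ofNat]; ring)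
  have hμE : μ ∈ L⟮μ⟯ := mem_adjoin_simple_self L μ
  -- The part 2vμ = 2c₂μ + 2c₃μω is split by conjugating ω over L(μ), which needs ω ∉ L(μ).
  obtain ⟨h3, h4⟩ := IsIntegral.add_sub_of_notMem (S := S) (E := L⟮μ⟯) (μ := ω)
    (by rw [hωL]; exact IntermediateField.algebraMap_mem _ _) (h.symm hωL hμL).notMem_adjoin
    (u := algebraMap L K (2 * c₂) * μ) (v := algebraMap L K (2 * c₃) * μ)
    (mul_mem (IntermediateField.algebraMap_mem _ _) hμE) (mul_mem (IntermediateField.algebraMap_mem _ _) hμE)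
    (by convert h2 using 1; simp only [map_mul, map_ofNat]; ring)
  obtain ⟨s₂, hs₂⟩ := hg.exists_algebraMap_eq_of_isIntegral_mul hμ (y := 2 * (2 * c₂))
    (by convert h3 using 1; simp only [map_mul, map_ofNat]; ring)
  obtain ⟨s₃, hs₃⟩ := (hf.mul hg hfg).exists_algebraMap_eq_of_isIntegral_mul (ρ := ω * μ)
    (by rw [mul_pow, hω, hμ, map_mul]) (y := 2 * (2 * c₃))
    (by convert h4 using 1; simp only [map_mul, map_ofNat]; ring)
  have key (s : S) (c : L) (hs : algebraMap S L s = 2 * (2 * c)) :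
      2 * (2 * algebraMap L K c) ∈ A := by
    have : 2 * (2 * algebraMap L K c) = algebraMap S K s := by
      rw [IsScalarTower.algebraMap_apply S L K, hs, map_mul, map_mul, map_ofNat]
    exact this ▸ _root_.algebraMap_mem A s
  have e : 2 * (2 * (algebraMap L K c₀ + algebraMap L K c₁ * ω +
      (algebraMap L K c₂ + algebraMap L K c₃ * ω) * μ)) = 2 * (2 * algebraMap L K c₀) +
      2 * (2 * algebraMap L K c₁) * ω + 2 * (2 * algebraMap L K c₂) * μ +
      2 * (2 * algebraMap L K c₃) * (ω * μ) := by ring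
  rw [e]
  exact add_mem (add_mem (add_mem (key _ _ hs₀) (mul_mem (key _ _ hs₁) hωA))
    (mul_mem (key _ _ hs₂) hμA)) (mul_mem (key _ _ hs₃) (mul_mem hωA hμA))

end Integral

lemma TwoClosed.mem_of_two_mul_mem {S K : Type*} [CommRing S] [Field K] [Algebra S K]
    [NeZero (2 : K)] {A : Subalgebra S K} (hA : TwoClosed A) {x : K} (hx : IsIntegral S x)
    (h : 2 * x ∈ A) : x ∈ A := by
  have e : 2 * x / 2 = x := mul_div_cancel_left₀ _ (NeZero.ne 2)
  simpa [e] using hA _ h (by rwa [e])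

/-! ### Freeness and construction of quadratic steps -/

namespace IsQuadraticOver

variable {S K : Type*} [CommRing S] [Field K] [Algebra S K] {A B : Subalgebra S K} {t : K}

/-- The linear isomorphism `B × B ≃ B ⊕ B t`. -/
noncomputable def prodEquiv (h : IsQuadraticOver A B t) : (B × B) ≃ₗ[S] A :=
  LinearEquiv.ofBijective
    { toFun := fun p : B × B ↦ (⟨p.1 + p.2 * t, (h.mem_iff _).mpr ⟨_, p.1.2, _, p.2.2, rfl⟩⟩ : A)
      map_add' := fun p q ↦ by ext; simp; ring
      map_smul' := fun s p ↦ by ext; simp [Algebra.smul_def]; ring }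
    ⟨(injective_iff_map_eq_zero _).mpr fun p hp ↦ by
      obtain ⟨h1, h2⟩ := h.eq_zero _ p.1.2 _ p.2.2 (congrArg Subtype.val hp)
      exact Prod.ext (Subtype.ext h1) (Subtype.ext h2), fun ⟨x, hx⟩ ↦ by
      obtain ⟨u, hu, v, hv, rfl⟩ := (h.mem_iff x).mp hx
      exact ⟨(⟨u, hu⟩, ⟨v, hv⟩), rfl⟩⟩

lemma free (h : IsQuadraticOver A B t) [Module.Free S B] : Module.Free S A :=
  .of_equiv h.prodEquiv

lemma finite (h : IsQuadraticOver A B t) [Module.Finite S B] : Module.Finite S A :=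
  .equiv h.prodEquiv

/-- A nontrivial relation u + vt = 0 would put t = -u/v in the field E. -/
lemma of_notMem {L : Type*} [Field L] [Algebra L K] {E : IntermediateField L K}
    {s : Set K} (hs : ∀ x ∈ Algebra.adjoin S s, x ∈ E) (htE : t ∉ E) {p q : K}
    (hp : p ∈ Algebra.adjoin S s) (hq : q ∈ Algebra.adjoin S s) (ht : t ^ 2 = p * t + q) :
    IsQuadraticOver (Algebra.adjoin S (insert t s)) (Algebra.adjoin S s) t where
  mem_iff := Algebra.mem_adjoin_insert_iff_of_sq_eq hp hq ht
  eq_zero u hu v hv h0 := by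
    have hv0 : v = 0 := by
      by_contra hv0
      refine htE ?_
      have : t = -u / v := by rw [eq_div_iff hv0]; linear_combination h0
      rw [this]
      exact div_mem (neg_mem (hs u hu)) (hs v hv)
    exact ⟨by simpa [hv0] using h0, hv0⟩

end IsQuadraticOver

/-- The étale step: `S[(ω + h) / 2]` when `4 ∣ f - h²`. -/
lemma adjoin_half_sq_eq {S K : Type*} [CommRing S] [Field K] [CharZero K] [Algebra S K] {f h a : S}
    {ω : K} (hω : ω ^ 2 = algebraMap S K f) (hfa : f = h ^ 2 + 2 * (2 * a)) :
    ((ω + algebraMap S K h) / 2) ^ 2 =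
      algebraMap S K h * ((ω + algebraMap S K h) / 2) + algebraMap S K a := by
  have : algebraMap S K f = algebraMap S K h ^ 2 + 2 * (2 * algebraMap S K a) := by
          simp only [hfa, map_add, map_mul, map_pow, map_ofNat]
  field_simp
  linear_combination hω + this

/-! ### When S[ω] is integrally closed -/

section Quadratic

open IntermediateField

variable {S L K : Type*} [CommRing S] [IsDomain S] [Field L] [CharZero L] [Algebra S L]
  [IsFractionRing S L] [Field K] [Algebra L K] [Algebra S K] [IsScalarTower S L K]

omit [IsDomain S] [CharZero L] [IsFractionRing S L] in
lemma IsQuadraticOver.of_notMem_bot {t : K} (ht : t ∉ (⊥ : IntermediateField L K)) {p q : S}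
    (htq : t ^ 2 = algebraMap S K p * t + algebraMap S K q) :
    IsQuadraticOver (Algebra.adjoin S {t}) ⊥ t := by
  have h := IsQuadraticOver.of_notMem (S := S) (s := ∅) (E := (⊥ : IntermediateField L K)) (fun x hx ↦ by
    rw [Algebra.adjoin_empty] at hx
    obtain ⟨s, rfl⟩ := Algebra.mem_bot.mp hx
    rw [IsScalarTower.algebraMap_apply S L K]
    exact IntermediateField.algebraMap_mem _ _) ht (_root_.algebraMap_mem _ p)
    (_root_.algebraMap_mem _ q) htq
  rwa [insert_empty_eq, Algebra.adjoin_empty] at h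

omit [IsDomain S] [CharZero L] [IsFractionRing S L] in
/-- `S[ω]` is integrally closed once it contains all integral elements of `L(ω)`. -/
lemma isIntegrallyClosed_adjoin_of_forall {f : S} {ω : K} (hω : ω ^ 2 = algebraMap S K f)
    (h : ∀ c d : L, IsIntegral S (algebraMap L K c + algebraMap L K d * ω) →
      algebraMap L K c + algebraMap L K d * ω ∈ Algebra.adjoin S {ω}) :
    IsIntegrallyClosed (Algebra.adjoin S {ω}) := by
  set A := Algebra.adjoin S {ω} with hA
  have hωL : ω ^ 2 = algebraMap L K (algebraMap S L f) := by
    rw [hω, IsScalarTower.algebraMap_apply S L K]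
  have hAL (x : K) (hx : x ∈ A) : x ∈ L⟮ω⟯ := by
    induction hx using Algebra.adjoin_induction with
    | mem x hx => exact hx ▸ mem_adjoin_simple_self L ω
    | algebraMap r =>
      rw [IsScalarTower.algebraMap_apply S L K]; exact IntermediateField.algebraMap_mem _ _
    | add x y _ _ hx hy => exact add_mem hx hy
    | mul x y _ _ hx hy => exact mul_mem hx hy
  have hAint : Algebra.IsIntegral S A := ⟨fun x ↦
    (isIntegral_algHom_iff A.val Subtype.val_injective).mp <|
      Algebra.adjoin_le (S := integralClosure S K) (s := {ω})
        (Set.singleton_subset_iff.mpr (isIntegral_of_sq_eq_algebraMap hω)) x.2⟩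
  refine (isIntegrallyClosed_iff (FractionRing A)).mpr fun {y} hy ↦ ?_
  have hinj : Function.Injective (algebraMap A K) := Subtype.val_injective
  -- The abstract fraction field of S[ω] is embedded in K; its image lies in L(ω), where the
  -- hypothesis applies.
  let j : FractionRing A →ₐ[A] K := IsFractionRing.liftAlgHom (g := Algebra.ofId A K) hinj
  have hj : IsIntegral S (j y) := isIntegral_trans (A := A) _ (hy.map j)
  have hjL : j y ∈ L⟮ω⟯ := by
    obtain ⟨a, b, -, rfl⟩ := IsFractionRing.div_surjective (A := A) y
    rw [map_div₀, j.commutes, j.commutes]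
    exact div_mem (hAL _ a.2) (hAL _ b.2)
  obtain ⟨c, d, hcd⟩ := (mem_adjoin_simple_iff_of_sq_eq hωL _).mp hjL
  refine ⟨⟨j y, hcd ▸ h c d (hcd ▸ hj)⟩, j.injective ?_⟩
  exact j.commutes _

variable [IsIntegrallyClosed S] [IsNoetherianRing S]

/-- The element ω + h is a root of T² - 2hT - 2a, Eisenstein at 2, so S[ω] is closed at 2. That
suffices, because twice any integral element of L(ω) lies in S[ω]. -/
lemma isIntegrallyClosed_adjoin_of_not_dvd (h2 : Prime (2 : S)) {f h a : S} (hf : IsSquareFreeElt f)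
    {ω : K} (hω : ω ^ 2 = algebraMap S K f) (hnot : ω ∉ (⊥ : IntermediateField L K))
    (hfa : f = h ^ 2 + 2 * a) (ha : ¬ 2 ∣ a) : IsIntegrallyClosed (Algebra.adjoin S {ω}) := by
  have hinj : Function.Injective (algebraMap S K) := by
    rw [IsScalarTower.algebraMap_eq S L K]
    exact (algebraMap L K).injective.comp (IsFractionRing.injective S L)
  have : CharZero K := charZero_of_injective_algebraMap (algebraMap L K).injective
  have hquad := IsQuadraticOver.of_notMem_bot (p := 0) (q := f) hnot (by simp [hω])
  have hclosed : TwoClosed (Algebra.adjoin S {ω}) :=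
    (hquad.add_right (_root_.algebraMap_mem _ h)).twoClosed (_root_.algebraMap_mem _ h)
      (_root_.algebraMap_mem _ a)
      (by
        have : algebraMap S K f = algebraMap S K h ^ 2 + 2 * algebraMap S K a := by
          simp only [hfa, map_add, map_mul, map_pow, map_ofNat]
        linear_combination hω + this)
      (twoRegular_bot hinj h2 ha) (twoRadical_bot hinj h2)
      (fun x hx ↦ by obtain ⟨s, rfl⟩ := Algebra.mem_bot.mp hx; exact isIntegral_algebraMap)
  refine isIntegrallyClosed_adjoin_of_forall (L := L) hω fun c d hcd ↦
    hclosed.mem_of_two_mul_mem hcd ?_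
  obtain ⟨⟨s, hs⟩, s', hs'⟩ := hf.two_mul_mem_of_isIntegral_add_mul hω hnot hcd
  refine (Algebra.mem_adjoin_singleton_iff_of_sq_eq (p := 0) (q := f) (by simp [hω]) _).mpr
    ⟨s, s', ?_⟩
  rw [IsScalarTower.algebraMap_apply S L K, IsScalarTower.algebraMap_apply S L K s', hs, hs',
    map_mul, map_mul, map_ofNat]
  ring

-- The witness is (ω + h)/2, a root of T² - hT - a/2. It is outside S[ω] because its numerator has
-- ω-coordinate 1, which the prime 2 does not divide.
omit [IsDomain S] [IsIntegrallyClosed S] [IsNoetherianRing S] in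
lemma not_isIntegrallyClosed_adjoin_of_dvd (h2 : Prime (2 : S)) {f h a : S}
    {ω : K} (hω : ω ^ 2 = algebraMap S K f) (hnot : ω ∉ (⊥ : IntermediateField L K))
    (hfa : f = h ^ 2 + 2 * a) (ha : 2 ∣ a) : ¬ IsIntegrallyClosed (Algebra.adjoin S {ω}) := by
  intro hcl
  obtain ⟨a, rfl⟩ := ha
  have hinj : Function.Injective (algebraMap S K) := by
    rw [IsScalarTower.algebraMap_eq S L K]
    exact (algebraMap L K).injective.comp (IsFractionRing.injective S L)
  have : CharZero K := charZero_of_injective_algebraMap (algebraMap L K).injective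
  have hquad := IsQuadraticOver.of_notMem_bot (p := 0) (q := f) hnot (by simp [hω])
  set A := Algebra.adjoin S {ω} with hA
  have : CharZero A :=
    ⟨fun m n hmn ↦ by exact_mod_cast congrArg (algebraMap A K) hmn⟩
  set ω' : A := ⟨ω, hquad.mem⟩ with hω'
  have hω2 : ω' ^ 2 = algebraMap S A f := Subtype.ext hω
  have h20 : (2 : FractionRing A) ≠ 0 := by
    simp
  obtain ⟨y, hy⟩ : ∃ y : A, algebraMap A (FractionRing A) y = algebraMap A (FractionRing A) (ω' + algebraMap S A h) / 2 := by
    refine IsIntegrallyClosed.isIntegral_iff.mp ⟨.X ^ 2 - .C (algebraMap S A h) * .X -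
      .C (algebraMap S A a), by monicity!, ?_⟩
    have e : (algebraMap A (FractionRing A) ω') ^ 2 =
        algebraMap A (FractionRing A) (algebraMap S A h) ^ 2 + 4 * algebraMap A (FractionRing A) (algebraMap S A a) := by
      rw [← map_pow, hω2, hfa]; simp only [map_add, map_mul, map_pow, map_ofNat]; ring
    simp only [Polynomial.eval₂_sub, Polynomial.eval₂_mul, Polynomial.eval₂_pow,
      Polynomial.eval₂_X, Polynomial.eval₂_C, map_add]
    field_simp
    linear_combination e
  have hy2 : (2 : A) * y = ω' + algebraMap S A h := by
    refine IsFractionRing.injective A (FractionRing A) ?_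
    rw [map_mul, hy, map_ofNat]; field_simp
  have hyK : 2 * (y : K) = ω + algebraMap S K h := congrArg Subtype.val hy2
  have h1 := (hquad.div_two_mem (_root_.algebraMap_mem _ h) (one_mem _) (by
    have : (algebraMap S K h + 1 * ω) / 2 = y := by
      rw [one_mul, add_comm, ← hyK]; simp
    rw [this]; exact y.2)).2
  rw [← map_one (algebraMap S K), algebraMap_div_two_mem_bot_iff hinj] at h1
  exact h2.not_isUnit (isUnit_of_dvd_one h1)

end Quadratic

/-! ### The integral closure in the biquadratic extension -/

section Biquadratic

open IntermediateField

variable {S L K : Type*} [CommRing S] [IsDomain S] [IsNoetherianRing S] [IsIntegrallyClosed S]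
  [Field L] [CharZero L] [Algebra S L] [IsFractionRing S L]
  [Field K] [Algebra L K] [Algebra S K] [IsScalarTower S L K]

omit [IsDomain S] [IsNoetherianRing S] [IsIntegrallyClosed S] [CharZero L] [IsFractionRing S L] in
lemma half_mem_iff [CharZero K] {h : S} {ω : K} {E : IntermediateField L K} :
    (ω + algebraMap S K h) / 2 ∈ E ↔ ω ∈ E := by
  have hh : algebraMap S K h ∈ E := by
    rw [IsScalarTower.algebraMap_apply S L K]; exact IntermediateField.algebraMap_mem _ _
  refine ⟨fun h' ↦ ?_, fun h' ↦ div_mem (add_mem h' hh) (ofNat_mem E 2)⟩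
  have e : ω = 2 * ((ω + algebraMap S K h) / 2) - algebraMap S K h := by field_simp; ring
  rw [e]
  exact sub_mem (mul_mem (ofNat_mem E 2) h') hh

omit [IsIntegrallyClosed S] in
lemma not_dvd_of_two_dvd (h2 : Prime (2 : S)) {f h a : S} (hf : IsSquareFreeElt f)
    (hfa : f = h ^ 2 + 2 * (2 * a)) : ¬ 2 ∣ h := by
  rintro ⟨c, rfl⟩
  exact hf.not_sq_dvd h2 ⟨c ^ 2 + a, by rw [hfa]; ring⟩

/-- If `2 ∣ a`, the integral closure of `S` is `S[τ₁, τ₂]` or `S[τ₁, μ]`, and is free. -/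
theorem IsBiquadratic.integralClosure_eq_adjoin (h2 : Prime (2 : S)) {f g h₁ h₂ a b : S}
    (hf : IsSquareFreeElt f) (hg : IsSquareFreeElt g) (hfg : NoCommonHeightOnePrime f g)
    {ω μ : K} (h : IsBiquadratic L ω μ) (hω : ω ^ 2 = algebraMap S K f)
    (hμ : μ ^ 2 = algebraMap S K g) (hfa : f = h₁ ^ 2 + 2 * a) (hgb : g = h₂ ^ 2 + 2 * b)
    (ha : 2 ∣ a) :
    Module.Free S (integralClosure S K) ∧ Module.Finite S (integralClosure S K) ∧
    (2 ∣ b → integralClosure S K = Algebra.adjoin S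
      {(ω + algebraMap S K h₁) / 2, (μ + algebraMap S K h₂) / 2}) ∧
    (¬ 2 ∣ b → integralClosure S K = Algebra.adjoin S {(ω + algebraMap S K h₁) / 2, μ}) := by
  have hinj : Function.Injective (algebraMap S K) := by
    rw [IsScalarTower.algebraMap_eq S L K]
    exact (algebraMap L K).injective.comp (IsFractionRing.injective S L)
  have : CharZero K := charZero_of_injective_algebraMap (algebraMap L K).injective
  obtain ⟨a, rfl⟩ := ha
  set τ := (ω + algebraMap S K h₁) / 2 with hτ
  have hτsq : τ ^ 2 = algebraMap S K h₁ * τ + algebraMap S K a := adjoin_half_sq_eq hω hfa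
  have hB : IsQuadraticOver (Algebra.adjoin S {τ}) ⊥ τ :=
    .of_notMem_bot (L := L) (half_mem_iff.not.mpr h.notMem_bot) hτsq
  have hBrad : TwoRadical (Algebra.adjoin S {τ}) :=
    hB.twoRadical (_root_.algebraMap_mem _ _) (_root_.algebraMap_mem _ _) hτsq
      (twoRegular_bot hinj h2 (not_dvd_of_two_dvd h2 hf hfa)) (twoRadical_bot hinj h2)
  have hBreg {c : S} (hc : ¬ 2 ∣ c) : TwoRegular (Algebra.adjoin S {τ}) (algebraMap S K c) :=
    hB.twoRegular (_root_.algebraMap_mem _ _) (twoRegular_bot hinj h2 hc)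
  have hτint : IsIntegral S τ := by
    refine ⟨.X ^ 2 - .C h₁ * .X - .C a, by monicity!, ?_⟩
    simp [hτsq]
  have hBint : Algebra.adjoin S {τ} ≤ integralClosure S K :=
    Algebra.adjoin_le fun x hx ↦ hx ▸ hτint
  have hBL (x : K) (hx : x ∈ Algebra.adjoin S {τ}) : x ∈ L⟮ω⟯ := by
    obtain ⟨c, d, rfl⟩ := (Algebra.mem_adjoin_singleton_iff_of_sq_eq hτsq x).mp hx
    have hS (s : S) : algebraMap S K s ∈ L⟮ω⟯ := by
      rw [IsScalarTower.algebraMap_apply S L K]; exact IntermediateField.algebraMap_mem _ _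
    exact add_mem (hS c) (mul_mem (hS d) (half_mem_iff.mpr (mem_adjoin_simple_self L ω)))
  have hBfree : Module.Free S (Algebra.adjoin S {τ}) := by
    have : Module.Free S (⊥ : Subalgebra S K) :=
      .of_equiv (Algebra.botEquivOfInjective hinj).symm.toLinearEquiv
    exact hB.free
  have hBfin : Module.Finite S (Algebra.adjoin S {τ}) := by
    have : Module.Finite S (⊥ : Subalgebra S K) :=
      .equiv (Algebra.botEquivOfInjective hinj).symm.toLinearEquiv
    exact hB.finite
  have hωmem {A : Subalgebra S K} (hA : τ ∈ A) : ω ∈ A := by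
    have e : ω = 2 * τ - algebraMap S K h₁ := by rw [hτ]; field_simp; ring
    rw [e]
    exact sub_mem (mul_mem (ofNat_mem A 2) hA) (_root_.algebraMap_mem _ _)
  -- For integral x, 4x lies in the ring, and closedness at 2 is applied twice to strip the factor
  -- 4.
  have key {β : K} (hA : IsQuadraticOver (Algebra.adjoin S {τ, β}) (Algebra.adjoin S {τ}) β)
      (hβ : IsIntegral S β) (hμA : μ ∈ Algebra.adjoin S {τ, β})
      (hcl : TwoClosed (Algebra.adjoin S {τ, β})) :
      Module.Free S (integralClosure S K) ∧ Module.Finite S (integralClosure S K) ∧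
        integralClosure S K = Algebra.adjoin S {τ, β} := by
    have heq : integralClosure S K = Algebra.adjoin S {τ, β} := by
      refine le_antisymm (fun x hx ↦ ?_) (Algebra.adjoin_le ?_)
      · have h4 := h.four_mul_mem hf hg hfg hω hμ (hωmem (hA.le hB.mem)) hμA hx
        refine hcl.mem_of_two_mul_mem hx (hcl.mem_of_two_mul_mem ?_ h4)
        exact mul_mem (ofNat_mem (integralClosure S K) 2) hx
      · rintro x (rfl | rfl)
        · exact hτint
        · exact hβ
    rw [heq]
    exact ⟨hA.free, hA.finite, rfl⟩
  by_cases hb : 2 ∣ b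
  · obtain ⟨b, rfl⟩ := hb
    set τ₂ := (μ + algebraMap S K h₂) / 2 with hτ₂
    have hτ₂sq : τ₂ ^ 2 = algebraMap S K h₂ * τ₂ + algebraMap S K b := adjoin_half_sq_eq hμ hgb
    have hA : IsQuadraticOver (Algebra.adjoin S {τ, τ₂}) (Algebra.adjoin S {τ}) τ₂ := by
      rw [Set.pair_comm]
      exact .of_notMem hBL (half_mem_iff.not.mpr h.notMem_adjoin) (_root_.algebraMap_mem _ _)
        (_root_.algebraMap_mem _ _) hτ₂sq
    have hcl := (hA.twoRadical (_root_.algebraMap_mem _ _) (_root_.algebraMap_mem _ _) hτ₂sq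
      (hBreg (not_dvd_of_two_dvd h2 hg hgb)) hBrad).twoClosed
    obtain ⟨h3, h4, h5⟩ := key hA
      ⟨.X ^ 2 - .C h₂ * .X - .C b, by monicity!, by simp [hτ₂sq]⟩
      (by
        have e : μ = 2 * τ₂ - algebraMap S K h₂ := by rw [hτ₂]; field_simp; ring
        rw [e]
        exact sub_mem (mul_mem (ofNat_mem _ 2) hA.mem) (_root_.algebraMap_mem _ _)) hcl
    exact ⟨h3, h4, fun _ ↦ h5, fun h' ↦ absurd (Dvd.intro _ rfl) h'⟩
  · have hA : IsQuadraticOver (Algebra.adjoin S {τ, μ}) (Algebra.adjoin S {τ}) μ := by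
      rw [Set.pair_comm]
      exact .of_notMem hBL h.notMem_adjoin (zero_mem _) (_root_.algebraMap_mem _ g) (by simp [hμ])
    -- The Eisenstein generator is μ + h₂, with (μ + h₂)² = 2h₂(μ + h₂) + 2b; it generates the same
    -- ring as μ over S[τ].
    have hcl := (hA.add_right (_root_.algebraMap_mem _ h₂)).twoClosed (_root_.algebraMap_mem _ h₂)
      (_root_.algebraMap_mem _ b)
      (by
        have : algebraMap S K g = algebraMap S K h₂ ^ 2 + 2 * algebraMap S K b := by
          simp only [hgb, map_add, map_mul, map_pow, map_ofNat]
        linear_combination hμ + this) (hBreg hb) hBrad hBint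
    obtain ⟨h3, h4, h5⟩ := key hA (isIntegral_of_sq_eq_algebraMap hμ) hA.mem hcl
    exact ⟨h3, h4, fun h' ↦ absurd h' hb, fun _ ↦ h5⟩

-- A square root of f in L would be integral, hence in S. A root of U² - g in L(ω) would force this
-- irreducible quadratic to have degree one.
omit [IsDomain S] [IsNoetherianRing S] [CharZero L] in
lemma IsBiquadratic.of_irreducible {f g : S} (hfsq : ¬ IsSquare f) {ω μ : K}
    (hω : ω ^ 2 = algebraMap S K f) (hμ : μ ^ 2 = algebraMap S K g)
    (hK : IntermediateField.adjoin L {ω, μ} = ⊤)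
    (hirr : Irreducible (Polynomial.X ^ 2 -
      Polynomial.C (algebraMap L (IntermediateField.adjoin L {ω}) (algebraMap S L g)))) :
    IsBiquadratic L ω μ where
  notMem_bot h' := by
    obtain ⟨c, rfl⟩ := mem_bot.mp h'
    rw [IsScalarTower.algebraMap_apply S L K, ← map_pow] at hω
    have hc := (algebraMap L K).injective hω
    obtain ⟨s, rfl⟩ := IsIntegrallyClosed.isIntegral_iff.mp
      (isIntegral_of_sq_eq_algebraMap hc)
    rw [← map_pow] at hc
    exact hfsq ⟨s, by rw [← IsFractionRing.injective S L hc, pow_two]⟩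
  notMem_adjoin h' := by
    have h1 := Polynomial.degree_eq_one_of_irreducible_of_root hirr (x := ⟨μ, h'⟩) (by
      simp only [Polynomial.IsRoot, Polynomial.eval_sub, Polynomial.eval_pow, Polynomial.eval_X,
        Polynomial.eval_C]
      refine sub_eq_zero.mpr (Subtype.ext ?_)
      change μ ^ 2 = algebraMap L K (algebraMap S L g)
      rw [hμ, IsScalarTower.algebraMap_apply S L K])
    rw [Polynomial.degree_X_pow_sub_C two_pos] at h1
    norm_num at h1
  adjoin_eq_top := hK

end Biquadratic

theorem proposition3p1
    {S L K : Type*}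
    [CommRing S] [IsDomain S] [IsNoetherianRing S] [IsIntegrallyClosed S]
    [Field L] [CharZero L] [Algebra S L] [IsFractionRing S L]
    [Field K] [Algebra L K] [Algebra S K] [IsScalarTower S L K]
    -- `2` is a prime element of `S` and `S/2S` is integrally closed
    (h2 : Prime (2 : S))
    (hS2 : IsIntegrallyClosed (S ⧸ Ideal.span {(2 : S)}))
    (f g : S)
    (hfsq : ¬ IsSquare f) (hgsq : ¬ IsSquare g)
    (hf : IsSquareFreeElt f) (hg : IsSquareFreeElt g)
    (hfg : NoCommonHeightOnePrime f g)
    -- `K = L(ω, μ)` with `ω² = f`, `μ² = g`, and `U² - g` irreducible over `L(ω)`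
    (ω μ : K)
    (hω : ω ^ 2 = algebraMap S K f) (hμ : μ ^ 2 = algebraMap S K g)
    (hK : IntermediateField.adjoin L {ω, μ} = ⊤)
    (hirr : Irreducible (Polynomial.X ^ 2 -
      Polynomial.C (algebraMap L (IntermediateField.adjoin L {ω}) (algebraMap S L g))))
    -- `f` and `g` are squares modulo `2S`
    (h₁ h₂ a b : S) (hfS : f = h₁ ^ 2 + 2 * a) (hgS : g = h₂ ^ 2 + 2 * b)
    (hnot : ¬ IsIntegrallyClosed (Algebra.adjoin S {ω}) ∨
      ¬ IsIntegrallyClosed (Algebra.adjoin S {μ})) :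
    Module.Free S (integralClosure S K) ∧
    (¬ IsIntegrallyClosed (Algebra.adjoin S {ω}) →
      ¬ IsIntegrallyClosed (Algebra.adjoin S {μ}) →
      integralClosure S K = Algebra.adjoin S
        {(ω + algebraMap S K h₁) / 2, (μ + algebraMap S K h₂) / 2}) ∧
    (¬ IsIntegrallyClosed (Algebra.adjoin S {ω}) →
      IsIntegrallyClosed (Algebra.adjoin S {μ}) →
      integralClosure S K = Algebra.adjoin S {(ω + algebraMap S K h₁) / 2, μ}) ∧
    (IsIntegrallyClosed (Algebra.adjoin S {ω}) →
      ¬ IsIntegrallyClosed (Algebra.adjoin S {μ}) →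
      integralClosure S K = Algebra.adjoin S {ω, (μ + algebraMap S K h₂) / 2}) ∧
    (IsRegularAtMaximals S → IsCohenMacaulay (integralClosure S K)) := by
  have hbi := IsBiquadratic.of_irreducible hfsq hω hμ hK hirr
  have hbi' := hbi.symm (f := algebraMap S L f) (g := algebraMap S L g)
    (by rw [hω, IsScalarTower.algebraMap_apply S L K])
    (by rw [hμ, IsScalarTower.algebraMap_apply S L K])
  have hωiff : IsIntegrallyClosed (Algebra.adjoin S {ω}) ↔ ¬ 2 ∣ a :=
    ⟨fun h ha ↦ not_isIntegrallyClosed_adjoin_of_dvd h2 hω hbi.notMem_bot hfS ha h,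
      isIntegrallyClosed_adjoin_of_not_dvd h2 hf hω hbi.notMem_bot hfS⟩
  have hμiff : IsIntegrallyClosed (Algebra.adjoin S {μ}) ↔ ¬ 2 ∣ b :=
    ⟨fun h hb ↦ not_isIntegrallyClosed_adjoin_of_dvd h2 hμ hbi'.notMem_bot hgS hb h,
      isIntegrallyClosed_adjoin_of_not_dvd h2 hg hμ hbi'.notMem_bot hgS⟩
  rw [hωiff, hμiff, not_not, not_not] at hnot ⊢
  have hleft := hbi.integralClosure_eq_adjoin h2 hf hg hfg hω hμ hfS hgS
  -- The case where 2 divides b but not a is the mixed case with (ω, f) and (μ, g) exchanged.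
  have hright := hbi'.integralClosure_eq_adjoin h2 hg hf (fun Q hQ hQ1 h ↦ hfg Q hQ hQ1 h.symm)
    hμ hω hgS hfS
  obtain ⟨hfree, hfin⟩ : Module.Free S (integralClosure S K) ∧
      Module.Finite S (integralClosure S K) := by
    rcases hnot with h | h
    · exact ⟨(hleft h).1, (hleft h).2.1⟩
    · exact ⟨(hright h).1, (hright h).2.1⟩
  refine ⟨hfree, fun ha hb ↦ (hleft ha).2.2.1 hb, fun ha hb ↦ (hleft ha).2.2.2 hb,
    fun ha hb ↦ ?_, fun hS ↦ hS.isCohenMacaulay_of_finite_of_flat⟩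
  rw [(hright hb).2.2.2 ha, Set.pair_comm]
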